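/- A \emph{subtree} of a finite tree $T$ is a nonempty connected induced subgraph of $T$, and the \emph{mean subtree order} $\mu_T$ of $T$ is the average number of vertices of a subtree of $T$, taken uniformly over all subtrees of $T$. The maximum of the mean subtree order over all trees with $n$ vertices is $n - 2\log_2 n + O(1)$. That is, there is an absolute constant $C$ such that for every integer $n \ge 1$ $$\Bigl|\max_{T}\mu_T - (n - 2\log_2 n)\Bigr| \le C,$$ where the maximum is over all trees $T$ with $n$ vertices. -/

import Mathlib

open Classical in
/-- The subtrees of a tree `T`, each given by its vertex set: the vertex sets whose induced
subgraph is connected. (`SimpleGraph.Connected` includes nonemptiness, so the empty set is not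
counted.) -/
noncomputable def subtrees {V : Type*} [Fintype V] (T : SimpleGraph V) : Finset (Finset V) :=
  Finset.univ.filter fun S : Finset V => (T.induce (S : Set V)).Connected

/-- The mean subtree order: the average number of vertices of a subtree. -/
noncomputable def meanSubtreeOrder {V : Type*} [Fintype V] (T : SimpleGraph V) : ℝ :=
  (∑ S ∈ subtrees T, (S.card : ℝ)) / ((subtrees T).card : ℝ)

/-- All values taken by the mean subtree order on trees with `n` vertices; every such tree is
isomorphic to one with vertex set `Fin n`. -/
def meanSubtreeOrders (n : ℕ) : Set ℝ :=
  {x | ∃ T : SimpleGraph (Fin n), T.IsTree ∧ meanSubtreeOrder T = x}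

open Finset

/-! Call the number of vertices that a subtree misses its deficiency; the claim is that the least
possible mean deficiency is 2 log₂ n + O(1). At least that much: a rooted tree is built from single
vertices by hanging it below a new root and by gluing at the root. Both moves preserve
`DeficiencyBound`, whose main term N log₂ N / 2 says that N root subtrees miss at least half of log₂
N vertices on average; the square pays for trees, such as paths, where N is small. Hence the mean
deficiency over root subtrees is at least log₂ n - 5 (`DeficiencyBound.logb_sub_le`). Splitting the
tree at a vertex v into two sides of linear size (`exists_balanced_side`) doubles this for subtrees
through v, and those avoiding v miss n/3 vertices anyway. At most that much: the baton, a path with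
k ≈ 2 log₂ n leaves at each end. The 4^k subtrees containing the path miss k leaves on average, and
since n² ≤ 2^k all others together contribute only O(4^k). -/

/-! ### The numerical invariant and its consequences -/

/-- The numerical invariant of a rooted tree of order `n` with `N` subtrees containing the root and
total deficiency `F`. -/
structure DeficiencyBound (n N : ℕ) (F : ℝ) : Prop where
  pos : 1 ≤ n
  le : n ≤ N
  logb_le : Real.logb 2 N ≤ n - 1
  bound : N * Real.logb 2 N / 2 + (n - 1 - Real.logb 2 N) ^ 2 / 2 ≤ F

theorem DeficiencyBound.singleton : DeficiencyBound 1 1 0 := by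
  constructor <;> simp

theorem add_one_mul_logb_ratio_le {N : ℕ} (hN : 2 ≤ N) :
    (N + 1 : ℝ) * (Real.logb 2 (N + 1) - Real.logb 2 N) ≤ 2 := by
  have hN0 : (0 : ℝ) < N := by positivity
  rcases hN.eq_or_lt with rfl | h
  · have h : (3 : ℝ) * (Real.logb 2 3 - Real.logb 2 2) = Real.logb 2 (27 / 8) := by
      rw [← Real.logb_div (by norm_num) (by norm_num)]
      rw [show (27 / 8 : ℝ) = (3 / 2) ^ 3 by norm_num, Real.logb_pow]; norm_num
    have h2 : Real.logb 2 (27 / 8) ≤ 2 := by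
      rw [Real.logb_le_iff_le_rpow (by norm_num) (by norm_num)]; norm_num
    push_cast; norm_num at h ⊢; linarith
  -- Here ln(1 + 1/N) ≤ 1/N suffices because 4/3 < 2 ln 2; at N = 2 it would give 3/2, which is too
  -- large.
  · have h3 : (3 : ℝ) ≤ N := by exact_mod_cast h
    rw [← Real.logb_div (by positivity) (by positivity), Real.logb]
    have h1 : Real.log ((N + 1) / N) ≤ 1 / N := by
      have := Real.log_le_sub_one_of_pos (show (0 : ℝ) < (N + 1) / N by positivity)
      have e : ((N : ℝ) + 1) / N - 1 = 1 / N := by field_simp; ring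
      linarith
    have h2 := Real.log_two_gt_d9
    rw [mul_div_assoc', div_le_iff₀ (by linarith)]
    have h4 : (N + 1 : ℝ) * Real.log ((N + 1) / N) ≤ (N + 1) * (1 / N) := by gcongr
    have h5 : (N + 1 : ℝ) * (1 / N) ≤ 4 / 3 := by
      rw [mul_one_div, div_le_iff₀ hN0]; linarith
    linarith

/-- Models a new root above the old one: the one extra root subtree is the new root alone, which
misses n vertices. -/
theorem DeficiencyBound.extend {n N : ℕ} {F : ℝ} (h : DeficiencyBound n N F) :
    DeficiencyBound (n + 1) (N + 1) (F + n) := by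
  obtain ⟨hn, hnN, hL, hF⟩ := h
  rcases (show 1 ≤ N by omega).eq_or_lt with rfl | hN
  · obtain rfl : n = 1 := by omega
    constructor <;> norm_num at *
    linarith
  · have hd := add_one_mul_logb_ratio_le hN
    have hN2 : (2 : ℝ) ≤ N := by exact_mod_cast hN
    have hL1 : 1 ≤ Real.logb 2 N := by
      rw [Real.le_logb_iff_rpow_le (by norm_num) (by linarith)]; simpa
    have hmono : Real.logb 2 N ≤ Real.logb 2 (N + 1) :=
      Real.logb_le_logb_of_le (by norm_num) (by linarith) (by linarith)
    set l := Real.logb 2 N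
    set l' := Real.logb 2 ((N : ℝ) + 1) with hl'
    have hd1 : l' - l ≤ 1 := by nlinarith
    refine ⟨by omega, by omega, ?_, ?_⟩
    · push_cast; linarith
    · push_cast
      rw [← hl']
      obtain ⟨δ, hδ⟩ : ∃ δ, δ = l' - l := ⟨_, rfl⟩
      obtain ⟨t, ht⟩ : ∃ t, t = (n : ℝ) - 1 - l := ⟨_, rfl⟩
      have e1 : l' = l + δ := by linarith
      have e2 : (n : ℝ) = t + 1 + l := by linarith
      rw [← hδ] at hd hd1
      rw [← ht] at hF
      rw [e1, e2]
      have hδ0 : 0 ≤ δ := by linarith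
      have ht0 : 0 ≤ t := by linarith
      nlinarith [mul_nonneg hδ0 ht0, mul_nonneg hδ0 (sub_nonneg.2 hd1)]

/-- Models gluing at the roots. The logarithmic terms add up exactly, and (a + b)² ≤ 2a² + 2b²
handles the squares when both counts are at least 2; a count of 1 forces a single vertex, whose
square is zero. -/
theorem DeficiencyBound.merge {n₁ N₁ n₂ N₂ : ℕ} {F₁ F₂ : ℝ} (h₁ : DeficiencyBound n₁ N₁ F₁)
    (h₂ : DeficiencyBound n₂ N₂ F₂) :
    DeficiencyBound (n₁ + n₂ - 1) (N₁ * N₂) (F₁ * N₂ + F₂ * N₁) := by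
  obtain ⟨hn, hnN, hL, hF⟩ := h₁
  obtain ⟨kn, knN, kL, kF⟩ := h₂
  have hc : ((n₁ + n₂ - 1 : ℕ) : ℝ) = n₁ + n₂ - 1 := by
    rw [Nat.cast_sub (by omega)]; push_cast; ring
  have hlog : Real.logb 2 ((N₁ * N₂ : ℕ) : ℝ) = Real.logb 2 N₁ + Real.logb 2 N₂ := by
    push_cast
    exact Real.logb_mul (by norm_cast; omega) (by norm_cast; omega)
  refine ⟨by omega, ?_, ?_, ?_⟩
  · calc n₁ + n₂ - 1 ≤ n₁ * n₂ := by
          obtain ⟨a, rfl⟩ := Nat.exists_eq_add_of_le hn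
          obtain ⟨b, rfl⟩ := Nat.exists_eq_add_of_le kn
          have : (1 + a) * (1 + b) = 1 + a + b + a * b := by ring
          omega
      _ ≤ N₁ * N₂ := Nat.mul_le_mul hnN knN
  · rw [hlog, hc]; linarith
  · rw [hlog, hc]
    have key : (n₁ + n₂ - 1 - 1 - (Real.logb 2 N₁ + Real.logb 2 N₂) : ℝ) ^ 2 ≤
        (n₁ - 1 - Real.logb 2 N₁) ^ 2 * N₂ + (n₂ - 1 - Real.logb 2 N₂) ^ 2 * N₁ := by
      have aux : ∀ n N : ℕ, 1 ≤ n → n ≤ N →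
          (2 : ℝ) ≤ N ∨ ((N : ℝ) = 1 ∧ (n - 1 - Real.logb 2 N : ℝ) = 0) := by
        intro n N h1 h2
        rcases (show 1 ≤ N by omega).eq_or_lt with rfl | h
        · obtain rfl : n = 1 := by omega
          right; simp
        · left; exact_mod_cast h
      rw [show (n₁ + n₂ - 1 - 1 - (Real.logb 2 N₁ + Real.logb 2 N₂) : ℝ) =
        (n₁ - 1 - Real.logb 2 N₁) + (n₂ - 1 - Real.logb 2 N₂) by ring]
      rcases aux n₁ N₁ hn hnN with h1 | ⟨h1, h1'⟩ <;> rcases aux n₂ N₂ kn knN with h2 | ⟨h2, h2'⟩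
      · generalize (n₁ - 1 - Real.logb 2 N₁ : ℝ) = a
        generalize (n₂ - 1 - Real.logb 2 N₂ : ℝ) = b
        nlinarith [sq_nonneg (a - b), mul_nonneg (sq_nonneg a) (sub_nonneg.2 h2),
          mul_nonneg (sq_nonneg b) (sub_nonneg.2 h1)]
      · rw [h2', h2]; nlinarith
      · rw [h1', h1]; nlinarith
      · rw [h1', h2', h1, h2]; simp
    have e1 := mul_le_mul_of_nonneg_right hF (Nat.cast_nonneg (α := ℝ) N₂)
    have e2 := mul_le_mul_of_nonneg_right kF (Nat.cast_nonneg (α := ℝ) N₁)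
    push_cast
    nlinarith

/-- Comparison of `log₂` with a linear function. -/
theorem logb_two_le {x a : ℝ} (hx : 0 < x) (k : ℕ) (ha : a = 2 ^ k) :
    Real.logb 2 x ≤ k + 3 / 2 * (x / a) := by
  have ha0 : 0 < a := by rw [ha]; positivity
  have e : Real.logb 2 x = k + Real.logb 2 (x / a) := by
    rw [Real.logb_div hx.ne' ha0.ne', ha, Real.logb_pow]; simp
  have h1 := Real.log_le_sub_one_of_pos (div_pos hx ha0)
  have h2 := Real.log_two_gt_d9
  have h3 : Real.logb 2 (x / a) ≤ 3 / 2 * (x / a) := by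
    rw [Real.logb, div_le_iff₀ (by linarith)]
    nlinarith [div_pos hx ha0]
  linarith

/-- If N ≥ n², the term N log₂ N / 2 is enough. Otherwise n - 1 - log₂ N is at least n/4, and the
square n²/32 absorbs the loss N log₂(n²/N) / 2 up to O(N). -/
theorem DeficiencyBound.logb_sub_le {n N : ℕ} {F : ℝ} (h : DeficiencyBound n N F) :
    N * (Real.logb 2 n - 5) ≤ F := by
  obtain ⟨hn, hnN, hL, hF⟩ := h
  have hn1 : (1 : ℝ) ≤ n := by exact_mod_cast hn
  have hN1 : (1 : ℝ) ≤ N := by exact_mod_cast hn.trans hnN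
  have hL0 : 0 ≤ Real.logb 2 N := Real.logb_nonneg (by norm_num) hN1
  rcases le_or_gt (n : ℝ) 32 with h32 | h32
  · have h5 : Real.logb 2 n ≤ 5 := by
      rw [Real.logb_le_iff_le_rpow (by norm_num) (by linarith)]; norm_num; exact_mod_cast h32
    have : 0 ≤ F := le_trans (by positivity) hF
    nlinarith
  · have hn4 := logb_two_le (x := n) (a := 16) (by linarith) 4 (by norm_num)
    rcases le_or_gt (2 * Real.logb 2 n) (Real.logb 2 N) with hle | hlt
    · nlinarith [sq_nonneg ((n : ℝ) - 1 - Real.logb 2 N)]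
    · have ht : (n : ℝ) / 4 ≤ n - 1 - Real.logb 2 N := by
        push_cast at hn4
        linarith
      have hy := logb_two_le (x := (n : ℝ) ^ 2 / N) (a := 32) (by positivity) 5 (by norm_num)
      rw [Real.logb_div (by positivity) (by positivity), Real.logb_pow] at hy
      have ht2 : ((n : ℝ) / 4) ^ 2 ≤ (n - 1 - Real.logb 2 N) ^ 2 := by gcongr
      have hy' : N * (2 * Real.logb 2 n - Real.logb 2 N) ≤ 5 * N + 3 / 64 * n ^ 2 := by
        have := mul_le_mul_of_nonneg_left hy (by linarith : (0 : ℝ) ≤ N)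
        have e : (N : ℝ) * ((5 : ℕ) + 3 / 2 * ((n : ℝ) ^ 2 / N / 32)) = 5 * N + 3 / 64 * n ^ 2 := by
          field_simp; push_cast; ring
        rw [e] at this
        exact_mod_cast this
      nlinarith


/-! ### Subtrees through a fixed vertex, and how they decompose -/

section RootedSubtrees
variable {V : Type*} (G : SimpleGraph V)

/-- `S` contains `v` and every vertex of `S` is reachable from `v` inside `S`, expressed through
adjacency-closed sets. -/
def ConnFrom (S : Finset V) (v : V) : Prop :=
  v ∈ S ∧ ∀ X : Set V, v ∈ X → (∀ x ∈ S, ∀ y ∈ S, x ∈ X → G.Adj x y → y ∈ X) → ∀ y ∈ S, y ∈ X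

variable {G}

/-- Closed sets are easy to enlarge or restrict across a cut, so the splitting lemmas below need no
walks. -/
theorem connFrom_iff {S : Finset V} {v : V} :
    ConnFrom G S v ↔ v ∈ S ∧ (G.induce (S : Set V)).Connected := by
  constructor
  · rintro ⟨hv, h⟩
    refine ⟨hv, ?_⟩
    have key : ∀ y ∈ S, y ∈ {y | ∃ hy : y ∈ S,
        (G.induce (S : Set V)).Reachable ⟨v, hv⟩ ⟨y, hy⟩} := by
      apply h
      · exact ⟨hv, SimpleGraph.Reachable.refl _⟩
      · rintro x hx y hy ⟨_, hr⟩ hadj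
        refine ⟨hy, hr.trans (SimpleGraph.Adj.reachable ?_)⟩
        simpa using hadj
    rw [SimpleGraph.connected_iff_exists_forall_reachable]
    exact ⟨⟨v, hv⟩, fun ⟨y, hy⟩ => (key y hy).2⟩
  · rintro ⟨hv, h⟩
    refine ⟨hv, fun X hvX hX y hy => ?_⟩
    obtain ⟨p⟩ := h.preconnected ⟨v, hv⟩ ⟨y, hy⟩
    have : ∀ a b : (S : Set V), (G.induce (S : Set V)).Walk a b → (a : V) ∈ X → (b : V) ∈ X := by
      intro a b p
      induction p with
      | nil => exact id
      | cons hadj _ ih => exact fun ha => ih (hX _ (Subtype.prop _) _ (Subtype.prop _) ha (by simpa using hadj))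
    exact this _ _ p hvX

variable (G)

open Classical in
/-- The subtrees of `G` inside `U` that contain `v`. -/
noncomputable def rootedSubtrees (U : Finset V) (v : V) : Finset (Finset V) :=
  U.powerset.filter fun S => ConnFrom G S v

/-- The total number of vertices of `U` missed by the subtrees inside `U` that contain `v`. -/
noncomputable def rootedDeficiency (U : Finset V) (v : V) : ℝ :=
  ∑ S ∈ rootedSubtrees G U v, ((#U : ℝ) - #S)

variable {G}

theorem mem_rootedSubtrees {U S : Finset V} {v : V} :
    S ∈ rootedSubtrees G U v ↔ S ⊆ U ∧ ConnFrom G S v := by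
  simp [rootedSubtrees]

theorem empty_notMem_rootedSubtrees {U : Finset V} {v : V} : ∅ ∉ rootedSubtrees G U v := by
  simp [mem_rootedSubtrees, ConnFrom]

theorem rootedSubtrees_singleton (v : V) : rootedSubtrees G {v} v = {{v}} := by
  ext S
  simp only [mem_rootedSubtrees, mem_singleton, subset_singleton_iff]
  constructor
  · rintro ⟨rfl | h, h'⟩
    · simp [ConnFrom] at h'
    · exact h
  · rintro rfl
    exact ⟨Or.inr rfl, by simp [ConnFrom]⟩

variable [DecidableEq V]

/-- To descend to one part, a closed set there is enlarged by the whole other part; this stays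
closed because vw is the only crossing edge. -/
theorem connFrom_edge_split {A B S : Finset V} {v w : V} (hAB : Disjoint A B) (hS : S ⊆ A ∪ B)
    (hv : v ∈ A) (hw : w ∈ B) (hvw : G.Adj v w)
    (hcut : ∀ x ∈ A, ∀ y ∈ B, G.Adj x y → x = v ∧ y = w) :
    ConnFrom G S v ↔ ConnFrom G (S ∩ A) v ∧ (S ∩ B = ∅ ∨ ConnFrom G (S ∩ B) w) := by
  have hcut' : ∀ x ∈ B, ∀ y ∈ A, G.Adj x y → x = w ∧ y = v := fun x hx y hy h =>
    (hcut y hy x hx h.symm).symm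
  have hS' : ∀ x ∈ S, x ∈ A ∨ x ∈ B := fun x hx => by simpa using hS hx
  have hnot : ∀ x ∈ A, x ∉ B := fun x hx => Finset.disjoint_left.1 hAB hx
  constructor
  · rintro ⟨hvS, h⟩
    refine ⟨⟨by simp [hvS, hv], fun X hvX hX y hy => ?_⟩, ?_⟩
    · have := h (X ∪ B) (Or.inl hvX) ?_ y (mem_of_mem_inter_left hy)
      · simp only [Set.mem_union, Finset.mem_coe, Finset.mem_inter] at this hy; grind
      · intro x hx y hy hxX hadj
        simp only [Set.mem_union, Finset.mem_coe, Finset.mem_inter] at *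
        grind
    · by_cases hw' : w ∈ S
      · refine Or.inr ⟨by simp [hw', hw], fun X hwX hX y hy => ?_⟩
        have := h (X ∪ A) (Or.inr hv) ?_ y (mem_of_mem_inter_left hy)
        · simp only [Set.mem_union, Finset.mem_coe, Finset.mem_inter] at this hy; grind
        · intro x hx y hy hxX hadj
          simp only [Set.mem_union, Finset.mem_coe, Finset.mem_inter] at *
          grind
      · left
        have := h A hv ?_
        · ext y; simp only [Finset.mem_coe, Finset.mem_inter] at *; grind
        · intro x hx y hy hxX hadj
          simp only [Finset.mem_coe] at *
          grind
  · rintro ⟨⟨hvS, h1⟩, h2⟩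
    refine ⟨mem_of_mem_inter_left hvS, fun X hvX hX => ?_⟩
    have hA := h1 X hvX fun x hx y hy => hX x (mem_of_mem_inter_left hx) y (mem_of_mem_inter_left hy)
    rcases h2 with h2 | ⟨hwS, h2⟩
    · intro y hy
      have : y ∉ S ∩ B := by simp [h2]
      grind
    · have hB := h2 X (hX v (mem_of_mem_inter_left hvS) w (mem_of_mem_inter_left hwS) hvX hvw)
        fun x hx y hy => hX x (mem_of_mem_inter_left hx) y (mem_of_mem_inter_left hy)
      grind

theorem connFrom_vertex_split {A B S : Finset V} {v : V} (hAB : A ∩ B = {v}) (hS : S ⊆ A ∪ B)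
    (hcut : ∀ x ∈ A, ∀ y ∈ B, G.Adj x y → x = v ∨ y = v) :
    ConnFrom G S v ↔ ConnFrom G (S ∩ A) v ∧ ConnFrom G (S ∩ B) v := by
  have hcut' : ∀ x ∈ B, ∀ y ∈ A, G.Adj x y → x = v ∨ y = v := fun x hx y hy h =>
    (hcut y hy x hx h.symm).symm
  have hS' : ∀ x ∈ S, x ∈ A ∨ x ∈ B := fun x hx => by simpa using hS hx
  have hboth : ∀ x, x ∈ A → x ∈ B → x = v := fun x h1 h2 => by
    have : x ∈ A ∩ B := by simp [h1, h2]
    simpa [hAB] using this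
  have hvAB : v ∈ A ∩ B := by simp [hAB]
  have hv : v ∈ A := (Finset.mem_inter.1 hvAB).1
  have hv' : v ∈ B := (Finset.mem_inter.1 hvAB).2
  constructor
  · rintro ⟨hvS, h⟩
    refine ⟨⟨by simp [hvS, hv], fun X hvX hX y hy => ?_⟩,
      ⟨by simp [hvS, hv'], fun X hvX hX y hy => ?_⟩⟩
    · have := h (X ∪ B) (Or.inl hvX) ?_ y (mem_of_mem_inter_left hy)
      · simp only [Set.mem_union, Finset.mem_coe, Finset.mem_inter] at this hy; grind
      · intro x hx y hy hxX hadj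
        simp only [Set.mem_union, Finset.mem_coe, Finset.mem_inter] at *
        grind
    · have := h (X ∪ A) (Or.inl hvX) ?_ y (mem_of_mem_inter_left hy)
      · simp only [Set.mem_union, Finset.mem_coe, Finset.mem_inter] at this hy; grind
      · intro x hx y hy hxX hadj
        simp only [Set.mem_union, Finset.mem_coe, Finset.mem_inter] at *
        grind
  · rintro ⟨⟨hvS, h1⟩, ⟨-, h2⟩⟩
    refine ⟨mem_of_mem_inter_left hvS, fun X hvX hX => ?_⟩
    have hA := h1 X hvX fun x hx y hy => hX x (mem_of_mem_inter_left hx) y (mem_of_mem_inter_left hy)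
    have hB := h2 X hvX fun x hx y hy => hX x (mem_of_mem_inter_left hx) y (mem_of_mem_inter_left hy)
    grind

/-- The inserted `∅` accounts for the subtrees that do not use the edge vw. -/
theorem rootedSubtrees_edge_split {A B : Finset V} {v w : V} (hAB : Disjoint A B)
    (hv : v ∈ A) (hw : w ∈ B) (hvw : G.Adj v w)
    (hcut : ∀ x ∈ A, ∀ y ∈ B, G.Adj x y → x = v ∧ y = w) (f : Finset V → ℝ) :
    ∑ S ∈ rootedSubtrees G (A ∪ B) v, f S =
      ∑ p ∈ rootedSubtrees G A v ×ˢ insert ∅ (rootedSubtrees G B w), f (p.1 ∪ p.2) := by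
  have hnot : ∀ x ∈ A, x ∉ B := fun x hx => Finset.disjoint_left.1 hAB hx
  symm
  refine Finset.sum_nbij' (fun p => p.1 ∪ p.2) (fun S => (S ∩ A, S ∩ B)) ?_ ?_ ?_ ?_ ?_
  · rintro ⟨P, Q⟩ h
    simp only [mem_product, mem_insert, mem_rootedSubtrees] at h ⊢
    have hQ : Q ⊆ B := by rcases h.2 with h | h <;> simp [h]
    have hP := h.1.1
    have hsub : P ∪ Q ⊆ A ∪ B := union_subset_union hP hQ
    refine ⟨hsub, (connFrom_edge_split hAB hsub hv hw hvw hcut).2 ?_⟩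
    have e1 : (P ∪ Q) ∩ A = P := by ext; grind
    have e2 : (P ∪ Q) ∩ B = Q := by ext; grind
    rw [e1, e2]
    exact ⟨h.1.2, h.2.imp id And.right⟩
  · intro S h
    simp only [mem_product, mem_insert, mem_rootedSubtrees] at h ⊢
    have := (connFrom_edge_split hAB h.1 hv hw hvw hcut).1 h.2
    exact ⟨⟨inter_subset_right, this.1⟩, this.2.imp id fun h => ⟨inter_subset_right, h⟩⟩
  · rintro ⟨P, Q⟩ h
    simp only [mem_product, mem_insert, mem_rootedSubtrees] at h
    have hQ : Q ⊆ B := by rcases h.2 with h | h <;> simp [h]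
    have hP := h.1.1
    ext <;> grind
  · intro S h
    simp only [mem_rootedSubtrees] at h
    rw [← inter_union_distrib_left, inter_eq_left.2 h.1]
  · intros; rfl

theorem rootedSubtrees_vertex_split {A B : Finset V} {v : V} (hAB : A ∩ B = {v})
    (hcut : ∀ x ∈ A, ∀ y ∈ B, G.Adj x y → x = v ∨ y = v) (f : Finset V → ℝ) :
    ∑ S ∈ rootedSubtrees G (A ∪ B) v, f S =
      ∑ p ∈ rootedSubtrees G A v ×ˢ rootedSubtrees G B v, f (p.1 ∪ p.2) := by
  have hboth : ∀ x, x ∈ A → x ∈ B → x = v := fun x h1 h2 => by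
    have : x ∈ A ∩ B := by simp [h1, h2]
    simpa [hAB] using this
  symm
  refine Finset.sum_nbij' (fun p => p.1 ∪ p.2) (fun S => (S ∩ A, S ∩ B)) ?_ ?_ ?_ ?_ ?_
  · rintro ⟨P, Q⟩ h
    simp only [mem_product, mem_rootedSubtrees] at h ⊢
    obtain ⟨⟨hP, h1⟩, hQ, h2⟩ := h
    have hsub : P ∪ Q ⊆ A ∪ B := union_subset_union hP hQ
    refine ⟨hsub, (connFrom_vertex_split hAB hsub hcut).2 ?_⟩
    have := h1.1
    have := h2.1
    have e1 : (P ∪ Q) ∩ A = P := by ext; grind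
    have e2 : (P ∪ Q) ∩ B = Q := by ext; grind
    rw [e1, e2]
    exact ⟨h1, h2⟩
  · intro S h
    simp only [mem_product, mem_rootedSubtrees] at h ⊢
    have := (connFrom_vertex_split hAB h.1 hcut).1 h.2
    exact ⟨⟨inter_subset_right, this.1⟩, inter_subset_right, this.2⟩
  · rintro ⟨P, Q⟩ h
    simp only [mem_product, mem_rootedSubtrees] at h
    obtain ⟨⟨hP, h1⟩, hQ, h2⟩ := h
    have := h1.1
    have := h2.1
    ext <;> grind
  · intro S h
    simp only [mem_rootedSubtrees] at h
    rw [← inter_union_distrib_left, inter_eq_left.2 h.1]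
  · intros; rfl

theorem card_rootedSubtrees_edge_split {A B : Finset V} {v w : V} (hAB : Disjoint A B)
    (hv : v ∈ A) (hw : w ∈ B) (hvw : G.Adj v w)
    (hcut : ∀ x ∈ A, ∀ y ∈ B, G.Adj x y → x = v ∧ y = w) :
    #(rootedSubtrees G (A ∪ B) v) = #(rootedSubtrees G A v) * (#(rootedSubtrees G B w) + 1) := by
  have := rootedSubtrees_edge_split hAB hv hw hvw hcut fun _ => 1
  rw [← card_insert_of_notMem (empty_notMem_rootedSubtrees (G := G) (U := B) (v := w)),
    ← card_product]
  simp only [sum_const, nsmul_eq_mul, mul_one] at this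
  exact_mod_cast this

theorem rootedDeficiency_edge_split {A B : Finset V} {v w : V} (hAB : Disjoint A B)
    (hv : v ∈ A) (hw : w ∈ B) (hvw : G.Adj v w)
    (hcut : ∀ x ∈ A, ∀ y ∈ B, G.Adj x y → x = v ∧ y = w) :
    rootedDeficiency G (A ∪ B) v = rootedDeficiency G A v * ((#(rootedSubtrees G B w) + 1 : ℕ) : ℝ) +
      (rootedDeficiency G B w + #B) * #(rootedSubtrees G A v) := by
  have hdis : ∀ P ∈ rootedSubtrees G A v, ∀ Q ∈ insert ∅ (rootedSubtrees G B w),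
      ((#(A ∪ B) : ℝ) - #(P ∪ Q)) = (#A - #P) + (#B - #Q) := by
    intro P hP Q hQ
    simp only [mem_insert, mem_rootedSubtrees] at hP hQ
    have hQ' : Q ⊆ B := by rcases hQ with h | h <;> simp [h]
    rw [card_union_of_disjoint hAB, card_union_of_disjoint (disjoint_of_subset_left hP.1
      (disjoint_of_subset_right hQ' hAB))]
    push_cast; ring
  rw [rootedDeficiency, rootedSubtrees_edge_split hAB hv hw hvw hcut, sum_product,
    sum_congr rfl fun P hP => sum_congr rfl fun Q hQ => hdis P hP Q hQ]
  simp_rw [sum_add_distrib, sum_const, ← smul_sum]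
  rw [sum_insert empty_notMem_rootedSubtrees,
    card_insert_of_notMem empty_notMem_rootedSubtrees]
  simp only [rootedDeficiency, nsmul_eq_mul, card_empty]
  push_cast; ring

theorem card_rootedSubtrees_vertex_split {A B : Finset V} {v : V} (hAB : A ∩ B = {v})
    (hcut : ∀ x ∈ A, ∀ y ∈ B, G.Adj x y → x = v ∨ y = v) :
    #(rootedSubtrees G (A ∪ B) v) = #(rootedSubtrees G A v) * #(rootedSubtrees G B v) := by
  have := rootedSubtrees_vertex_split hAB hcut fun _ => 1
  rw [← card_product]
  simp only [sum_const, nsmul_eq_mul, mul_one] at this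
  exact_mod_cast this

theorem rootedDeficiency_vertex_split {A B : Finset V} {v : V} (hAB : A ∩ B = {v})
    (hcut : ∀ x ∈ A, ∀ y ∈ B, G.Adj x y → x = v ∨ y = v) :
    rootedDeficiency G (A ∪ B) v = rootedDeficiency G A v * #(rootedSubtrees G B v) +
      rootedDeficiency G B v * #(rootedSubtrees G A v) := by
  have hdis : ∀ P ∈ rootedSubtrees G A v, ∀ Q ∈ rootedSubtrees G B v,
      ((#(A ∪ B) : ℝ) - #(P ∪ Q)) = (#A - #P) + (#B - #Q) := by
    intro P hP Q hQ
    simp only [mem_rootedSubtrees] at hP hQ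
    have h1 : P ∩ Q = {v} := by
      apply Subset.antisymm
      · rw [← hAB]; exact inter_subset_inter hP.1 hQ.1
      · simp [hP.2.1, hQ.2.1]
    have e1 : (#(A ∪ B) : ℝ) + 1 = #A + #B := by
      have := card_union_add_card_inter A B
      rw [hAB, card_singleton] at this
      exact_mod_cast this
    have e2 : (#(P ∪ Q) : ℝ) + 1 = #P + #Q := by
      have := card_union_add_card_inter P Q
      rw [h1, card_singleton] at this
      exact_mod_cast this
    linarith
  rw [rootedDeficiency, rootedSubtrees_vertex_split hAB hcut, sum_product,
    sum_congr rfl fun P hP => sum_congr rfl fun Q hQ => hdis P hP Q hQ]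
  simp_rw [sum_add_distrib, sum_const, ← smul_sum]
  simp only [rootedDeficiency, nsmul_eq_mul]
  ring

/-- Removing an edge `vw` of a forest separates the side of `w` from the side of `v`. -/
theorem exists_branch [Fintype V] (hG : G.IsAcyclic) {v w : V} (hvw : G.Adj v w) :
    ∃ B : Finset V, w ∈ B ∧ v ∉ B ∧ ∀ x ∉ B, ∀ y ∈ B, G.Adj x y → x = v ∧ y = w := by
  classical
  have hb := SimpleGraph.isAcyclic_iff_forall_isBridge.1 hG (e := s(v, w)) hvw
  rw [SimpleGraph.isBridge_iff] at hb
  let H := G.deleteEdges {s(v, w)}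
  refine ⟨univ.filter fun x => H.Reachable w x, by simp, ?_, ?_⟩
  · simp only [mem_filter, mem_univ, true_and]
    intro h
    exact hb h.symm
  · intro x hx y hy hxy
    simp only [mem_filter, mem_univ, true_and] at hx hy
    by_cases he : s(x, y) = s(v, w)
    · rcases Sym2.eq_iff.1 he with h | ⟨rfl, rfl⟩
      · exact h
      · exact absurd (SimpleGraph.Reachable.refl _) hx
    · exact absurd (hy.trans (SimpleGraph.Adj.reachable (by
        simp only [H, SimpleGraph.deleteEdges_adj, Set.mem_singleton_iff]
        exact ⟨hxy.symm, by rwa [Sym2.eq_swap]⟩))) hx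

/-- Cutting an edge vw at the root leaves two smaller rooted trees; extending the one at w by v and
merging recovers the original. -/
theorem ConnFrom.deficiencyBound [Fintype V] (hG : G.IsAcyclic) {U : Finset V} {v : V}
    (hU : ConnFrom G U v) :
    DeficiencyBound #U #(rootedSubtrees G U v) (rootedDeficiency G U v) := by
  induction hk : #U using Nat.strong_induction_on generalizing U v with
  | _ k ih =>
  subst hk
  by_cases h1 : U = {v}
  · subst h1
    simpa [rootedDeficiency, rootedSubtrees_singleton] using DeficiencyBound.singleton
  · obtain ⟨w, hwU, hvw⟩ : ∃ w ∈ U, G.Adj v w := by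
      by_contra! hno
      apply h1
      have := hU.2 {v} rfl (by rintro x hx y hy rfl hadj; exact absurd hadj (hno y hy))
      exact eq_singleton_iff_unique_mem.2 ⟨hU.1, this⟩
    obtain ⟨B, hwB, hvB, hB⟩ := exists_branch hG hvw
    have hdis : Disjoint (U \ B) (U ∩ B) := disjoint_sdiff_inter U B
    have hun : U \ B ∪ U ∩ B = U := sdiff_union_inter U B
    have hv' : v ∈ U \ B := by simp [hU.1, hvB]
    have hw' : w ∈ U ∩ B := by simp [hwU, hwB]
    have hcut : ∀ x ∈ U \ B, ∀ y ∈ U ∩ B, G.Adj x y → x = v ∧ y = w := fun x hx y hy =>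
      hB x (mem_sdiff.1 hx).2 y (mem_inter.1 hy).2
    have hcard : #(U \ B) + #(U ∩ B) = #U := card_sdiff_add_card_inter U B
    have hp1 : 0 < #(U \ B) := card_pos.2 ⟨v, hv'⟩
    have hp2 : 0 < #(U ∩ B) := card_pos.2 ⟨w, hw'⟩
    have hc := (connFrom_edge_split hdis hun.ge hv' hw' hvw hcut).1 hU
    have e1 : U ∩ (U \ B) = U \ B := inter_eq_right.2 sdiff_subset
    have e2 : U ∩ (U ∩ B) = U ∩ B := inter_eq_right.2 inter_subset_left
    rw [e1, e2] at hc
    have hc2 := hc.2.resolve_left (Finset.nonempty_iff_ne_empty.1 ⟨w, hw'⟩)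
    have i1 := ih _ (by omega) hc.1 rfl
    have i2 := (ih _ (by omega) hc2 rfl).extend
    have := i1.merge i2
    rw [← card_rootedSubtrees_edge_split hdis hv' hw' hvw hcut,
      ← rootedDeficiency_edge_split hdis hv' hw' hvw hcut, hun] at this
    convert this using 1
    omega

end RootedSubtrees


/-! ### Upper bound: splitting at a balanced vertex -/

section UpperBound
variable {V : Type*} [Fintype V] {G : SimpleGraph V}

/-- `A` consists of `v` and a union of branches at `v`. -/
def IsSide (G : SimpleGraph V) (v : V) (A : Finset V) : Prop :=
  v ∈ A ∧ ∀ x ∈ A, x ≠ v → ∀ y ∉ A, ¬ G.Adj x y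

theorem SimpleGraph.Connected.connFrom_univ (hG : G.Connected) (v : V) : ConnFrom G univ v := by
  refine connFrom_iff.2 ⟨mem_univ v, ?_⟩
  rw [coe_univ]
  exact (SimpleGraph.induceUnivIso G).connected_iff.2 hG

theorem mem_subtrees {S : Finset V} : S ∈ subtrees G ↔ (G.induce (S : Set V)).Connected := by
  simp [subtrees]

theorem subtrees_nonempty (hG : G.IsTree) : (subtrees G).Nonempty := by
  obtain ⟨v⟩ := hG.connected.nonempty
  exact ⟨univ, mem_subtrees.2 (connFrom_iff.1 (hG.connected.connFrom_univ v)).2⟩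

theorem meanSubtreeOrder_eq_sub (hG : G.IsTree) :
    meanSubtreeOrder G = Fintype.card V -
      (∑ S ∈ subtrees G, ((Fintype.card V : ℝ) - #S)) / #(subtrees G) := by
  have : (0 : ℝ) < #(subtrees G) := by exact_mod_cast card_pos.2 (subtrees_nonempty hG)
  rw [meanSubtreeOrder, sum_sub_distrib, sum_const, nsmul_eq_mul]
  field_simp
  ring

variable [DecidableEq V]

/-- Take a smallest side with at least n/3 vertices. Cutting one of its edges at v splits it into
two smaller sides, each below n/3, so it has fewer than 2n/3 vertices; the slack 3 covers the side
`{v}`. -/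
theorem exists_balanced_side (hG : G.IsTree) :
    ∃ v A, IsSide G v A ∧ Fintype.card V ≤ 3 * #A ∧ 3 * #A ≤ 2 * Fintype.card V + 3 := by
  classical
  obtain ⟨v₀⟩ := hG.connected.nonempty
  have hex : ∃ k, ∃ v A, IsSide G v A ∧ Fintype.card V ≤ 3 * #A ∧ #A = k :=
    ⟨_, v₀, univ, ⟨mem_univ _, by simp⟩, by rw [card_univ]; omega, rfl⟩
  obtain ⟨v, A, hA, hn, hk⟩ := Nat.find_spec hex
  have hmin : ∀ v' A', IsSide G v' A' → #A' < #A → 3 * #A' < Fintype.card V := by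
    intro v' A' h' hlt
    by_contra! hge
    exact Nat.find_min hex (hk ▸ hlt) ⟨v', A', h', hge, rfl⟩
  refine ⟨v, A, hA, hn, ?_⟩
  by_cases h1 : A = {v}
  · simp [h1]
  obtain ⟨hvA, hA⟩ := hA
  obtain ⟨w, hwA, hvw⟩ : ∃ w ∈ A, G.Adj v w := by
    by_contra! hno
    obtain ⟨x, hx, hxv⟩ : ∃ x ∈ A, x ≠ v := by
      by_contra! h; exact h1 (eq_singleton_iff_unique_mem.2 ⟨hvA, h⟩)
    have := (hG.connected.connFrom_univ x).2 {y | y ∈ A ∧ y ≠ v} ⟨hx, hxv⟩ ?_ v (mem_univ v)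
    · exact this.2 rfl
    · rintro a - b - ⟨ha, hav⟩ hadj
      refine ⟨by_contra fun hb => hA a ha hav b hb hadj, ?_⟩
      rintro rfl
      exact hno a ha hadj.symm
  obtain ⟨B, hwB, hvB, hB⟩ := exists_branch hG.isAcyclic hvw
  have hcard : #(A \ B) + #(A ∩ B) = #A := card_sdiff_add_card_inter A B
  have hp1 : 0 < #(A \ B) := card_pos.2 ⟨v, by simp [hvA, hvB]⟩
  have hp2 : 0 < #(A ∩ B) := card_pos.2 ⟨w, by simp [hwA, hwB]⟩
  have s1 : IsSide G v (A \ B) := by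
    refine ⟨by simp [hvA, hvB], fun x hx hxv y hy hadj => ?_⟩
    rw [mem_sdiff] at hx hy
    by_cases hyA : y ∈ A
    · exact hxv (hB x hx.2 y (by tauto) hadj).1
    · exact hA x hx.1 hxv y hyA hadj
  have s2 : IsSide G w (A ∩ B) := by
    refine ⟨by simp [hwA, hwB], fun x hx hxw y hy hadj => ?_⟩
    rw [mem_inter] at hx hy
    by_cases hyA : y ∈ A
    · exact hxw (hB y (by tauto) x hx.2 hadj.symm).2
    · exact hA x hx.1 (by rintro rfl; exact hvB hx.2) y hyA hadj
  have := hmin _ _ s1 (by omega)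
  have := hmin _ _ s2 (by omega)
  omega

theorem filter_mem_subtrees (v : V) :
    (subtrees G).filter (v ∈ ·) = rootedSubtrees G univ v := by
  ext S
  simp [mem_subtrees, mem_rootedSubtrees, connFrom_iff, and_comm]

/-- Only v links `A` to the rest, so a connected set avoiding v lies in `A.erase v` or in `Aᶜ`. -/
theorem IsSide.card_le_of_notMem {v : V} {A S : Finset V} (hA : IsSide G v A)
    (h2 : 3 * #A ≤ 2 * Fintype.card V + 3) (h1 : Fintype.card V ≤ 3 * #A)
    (hS : S ∈ subtrees G) (hv : v ∉ S) : 3 * #S ≤ 2 * Fintype.card V := by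
  have hc := mem_subtrees.1 hS
  obtain ⟨⟨s, hs⟩⟩ := hc.nonempty
  have hs : s ∈ S := hs
  have hcs : ConnFrom G S s := connFrom_iff.2 ⟨hs, hc⟩
  have hne : ∀ x ∈ S, x ≠ v := by rintro x hx rfl; exact hv hx
  by_cases hsA : s ∈ A
  · have hsub : S ⊆ A.erase v := fun y hy => mem_erase.2 ⟨hne y hy, hcs.2 A hsA
      (fun x hx y _ hxA hadj => by_contra fun hy => hA.2 x hxA (hne x hx) y hy hadj) y hy⟩
    have := card_le_card hsub
    rw [card_erase_of_mem hA.1] at this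
    have := card_pos.2 ⟨v, hA.1⟩
    omega
  · have hsub : S ⊆ Aᶜ := fun y hy => mem_compl.2 (hcs.2 {x | x ∉ A} hsA
      (fun x _ y hy hxA hadj hyA => hA.2 y hyA (hne y hy) x hxA hadj.symm) y hy)
    have := card_le_card hsub
    rw [card_compl] at this
    omega

theorem sum_deficiency_lower_bound (hG : G.IsTree) :
    #(subtrees G) * (2 * Real.logb 2 (Fintype.card V) - 14) ≤
      ∑ S ∈ subtrees G, ((Fintype.card V : ℝ) - #S) := by
  obtain ⟨v, A, hA, h1, h2⟩ := exists_balanced_side hG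
  have hcv : 0 < Fintype.card V := Fintype.card_pos_iff.2 ⟨v⟩
  have hcard : #(insert v Aᶜ) + #A = Fintype.card V + 1 := by
    rw [card_insert_of_notMem (by simp [hA.1]), card_compl]
    have := card_le_univ A
    omega
  set n := Fintype.card V
  set A' := insert v Aᶜ with hA'
  have hinter : A ∩ A' = {v} := by
    ext x; have := hA.1; simp only [hA', mem_inter, mem_insert, mem_compl, mem_singleton]; grind
  have hunion : A ∪ A' = univ := by
    ext x; simp only [hA', mem_union, mem_insert, mem_compl, mem_univ]; tauto
  have hcut : ∀ x ∈ A, ∀ y ∈ A', G.Adj x y → x = v ∨ y = v := by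
    intro x hx y hy hadj
    simp only [hA', mem_insert, mem_compl] at hy
    rcases hy with rfl | hy
    · exact Or.inr rfl
    · exact Or.inl (by_contra fun hne => hA.2 x hx hne y hy hadj)
  have hconn := (connFrom_vertex_split hinter hunion.ge hcut).1 (hG.connected.connFrom_univ v)
  rw [univ_inter, univ_inter] at hconn
  have b1 := (hconn.1.deficiencyBound hG.isAcyclic).logb_sub_le
  have b2 := (hconn.2.deficiencyBound hG.isAcyclic).logb_sub_le
  -- Weakening n/3 to n/4 costs exactly 2 in the logarithm, so each side contributes log₂ n - 7.
  have hlog : ∀ m : ℕ, n ≤ 3 * m → Real.logb 2 n - 2 ≤ Real.logb 2 m := by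
    intro m hm
    have hm' : (n : ℝ) / 4 ≤ m := by
      have : (n : ℝ) ≤ 3 * m := by exact_mod_cast hm
      linarith [(Nat.cast_nonneg m : (0 : ℝ) ≤ m)]
    have hn0 : (0 : ℝ) < n := by exact_mod_cast hcv
    have := Real.logb_le_logb_of_le (b := 2) (by norm_num) (by positivity) hm'
    rwa [Real.logb_div hn0.ne' (by norm_num), show (4 : ℝ) = 2 ^ 2 by norm_num, Real.logb_pow,
      Real.logb_self_eq_one (by norm_num), Nat.cast_ofNat, mul_one] at this
  have l1 := hlog _ h1
  have l2 := hlog #A' (by omega)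
  have hroot : #(rootedSubtrees G univ v) * (2 * Real.logb 2 n - 14) ≤
      rootedDeficiency G univ v := by
    rw [← hunion, card_rootedSubtrees_vertex_split hinter hcut,
      rootedDeficiency_vertex_split hinter hcut]
    push_cast
    have c1 := mul_le_mul_of_nonneg_right b1 (Nat.cast_nonneg (α := ℝ) #(rootedSubtrees G A' v))
    have c2 := mul_le_mul_of_nonneg_right b2 (Nat.cast_nonneg (α := ℝ) #(rootedSubtrees G A v))
    have c3 : (0 : ℝ) ≤ #(rootedSubtrees G A v) * #(rootedSubtrees G A' v) := by positivity
    nlinarith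
  rw [← card_filter_add_card_filter_not (s := subtrees G) (v ∈ ·),
    ← sum_filter_add_sum_filter_not (subtrees G) (v ∈ ·), filter_mem_subtrees]
  push_cast
  rw [add_mul]
  refine add_le_add ?_ ?_
  · simpa [rootedDeficiency, n] using hroot
  · rw [← nsmul_eq_mul]
    refine card_nsmul_le_sum _ _ _ fun S hS => ?_
    rw [mem_filter] at hS
    have h3 := hA.card_le_of_notMem h2 h1 hS.1 hS.2
    have h3' : (3 : ℝ) * #S ≤ 2 * n := by exact_mod_cast h3
    have h4 := logb_two_le (x := n) (a := 16) (by exact_mod_cast hcv) 4 (by norm_num)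
    push_cast at h4
    linarith [(Nat.cast_nonneg n : (0 : ℝ) ≤ n)]

theorem meanSubtreeOrder_le (hG : G.IsTree) :
    meanSubtreeOrder G ≤ Fintype.card V - 2 * Real.logb 2 (Fintype.card V) + 14 := by
  have h0 : (0 : ℝ) < #(subtrees G) := by exact_mod_cast card_pos.2 (subtrees_nonempty hG)
  have := sum_deficiency_lower_bound hG
  rw [mul_comm, ← le_div_iff₀ h0] at this
  rw [meanSubtreeOrder_eq_sub hG]
  linarith

end UpperBound


/-! ### Lower bound: batons -/

section LowerBound

/-- A graph in which every vertex other than `r` has a unique neighbour of smaller rank, and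
adjacent vertices have different ranks, is a tree. -/
theorem isTree_of_rank {V : Type*} [Fintype V] {G : SimpleGraph V} (r : V) (rank : V → ℕ)
    (hr : rank r = 0) (hpar : ∀ x, x ≠ r → ∃ y, G.Adj x y ∧ rank y < rank x)
    (hne : ∀ x y, G.Adj x y → rank x ≠ rank y)
    (huniq : ∀ x y z, G.Adj x y → G.Adj x z → rank y < rank x → rank z < rank x → y = z) :
    G.IsTree := by
  rw [SimpleGraph.isTree_iff_connected_and_card]
  constructor
  · rw [SimpleGraph.connected_iff_exists_forall_reachable]
    refine ⟨r, fun x => ?_⟩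
    induction hk : rank x using Nat.strong_induction_on generalizing x with
    | _ k ih =>
      by_cases hx : x = r
      · rw [hx]
      · obtain ⟨y, hxy, hlt⟩ := hpar x hx
        exact (ih _ (hk ▸ hlt) y rfl).trans hxy.symm.reachable
  · choose par hadj hlt using hpar
    -- Each edge is the parent edge of its endpoint of larger rank, so edges correspond to non-root
    -- vertices.
    let f : {x // x ≠ r} → G.edgeSet := fun x => ⟨s(x, par x x.2), hadj x x.2⟩
    have hf : Function.Bijective f := by
      constructor
      · rintro ⟨x, hx⟩ ⟨y, hy⟩ h
        rcases Sym2.eq_iff.1 (congrArg Subtype.val h) with h | ⟨h1, h2⟩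
        · exact Subtype.ext h.1
        · have h1 : x = par y hy := h1
          have h2 : par x hx = y := h2
          have a := hlt x hx
          have b := hlt y hy
          rw [h2] at a
          rw [← h1] at b
          omega
      · rintro ⟨e, he⟩
        induction e with
        | _ x y =>
          have hxy : G.Adj x y := he
          rcases (hne x y hxy).lt_or_gt with h | h
          · have hy : y ≠ r := by rintro rfl; omega
            refine ⟨⟨y, hy⟩, Subtype.ext ?_⟩
            simp only [f]
            rw [huniq y _ _ (hadj y hy) hxy.symm (hlt y hy) h, Sym2.eq_swap]
          · have hx : x ≠ r := by rintro rfl; omega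
            refine ⟨⟨x, hx⟩, Subtype.ext ?_⟩
            simp only [f]
            rw [huniq x _ _ (hadj x hx) hxy (hlt x hx) h]
    classical
    rw [← Nat.card_congr (Equiv.ofBijective f hf), Nat.card_eq_fintype_card,
      Nat.card_eq_fintype_card, Fintype.card_subtype_compl, Fintype.card_subtype_eq]
    have := Fintype.card_pos_iff.2 ⟨r⟩
    omega

/-- The edges `ij`, `i < j`, of the baton: a path from `k` to `n - k - 1` with `k` leaves attached
to each of its ends. -/
def BatonEdge (n k i j : ℕ) : Prop :=
  (i < k ∧ j = k) ∨ (k ≤ i ∧ j = i + 1 ∧ j + k < n) ∨ (i + k + 1 = n ∧ i < j)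

/-- The baton on `n` vertices with `k` leaves at each end. -/
def baton (n k : ℕ) : SimpleGraph (Fin n) where
  Adj i j := BatonEdge n k i j ∨ BatonEdge n k j i
  symm := ⟨fun _ _ h => h.symm⟩
  loopless := ⟨fun i h => by simp only [BatonEdge] at h; omega⟩

variable {n k : ℕ}

theorem baton_adj {i j : Fin n} :
    (baton n k).Adj i j ↔ BatonEdge n k i j ∨ BatonEdge n k j i := Iff.rfl

theorem baton_isTree (h : 2 * k + 2 ≤ n) : (baton n k).IsTree := by
  refine isTree_of_rank (⟨k, by omega⟩ : Fin n)
    (fun i => if i.val < k then 1 else if i.val + k < n then i.val - k else n) (by simp; omega) ?_ ?_ ?_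
  · rintro ⟨x, hx⟩ hne
    have hne : x ≠ k := by simpa using hne
    simp only [baton_adj, BatonEdge]
    by_cases h1 : x < k
    · exact ⟨⟨k, by omega⟩, by simp; omega, by simp [h1]; omega⟩
    · by_cases h2 : x + k < n
      · refine ⟨⟨x - 1, by omega⟩, by simp; omega, ?_⟩
        simp only
        split_ifs <;> omega
      · refine ⟨⟨n - k - 1, by omega⟩, by simp; omega, ?_⟩
        simp only
        split_ifs <;> omega
  · rintro ⟨x, hx⟩ ⟨y, hy⟩ hadj
    simp only [baton_adj, BatonEdge] at hadj ⊢
    split_ifs <;> omega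
  · rintro ⟨x, hx⟩ ⟨y, hy⟩ ⟨z, hz⟩ hxy hxz
    simp only [baton_adj, BatonEdge, Fin.mk.injEq] at hxy hxz ⊢
    split_ifs <;> omega

/-- The numbering runs left leaves, path, right leaves, so no edge jumps over a path vertex x except
those joining an end to its own leaves, on one side of x or at x itself. -/
theorem baton_lt_of_notMem {S : Finset (Fin n)} {a x : Fin n} (hS : ConnFrom (baton n k) S a)
    (hx : x ∉ S) (h1 : k ≤ x.val) (h2 : x.val + k < n) (hax : a < x) : ∀ y ∈ S, y < x := by
  refine hS.2 {y | y < x} hax fun i hi j hj hix hadj => ?_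
  have hne : j ≠ x := by rintro rfl; exact hx hj
  simp only [Set.mem_ofPred_eq, Fin.lt_def, baton_adj, BatonEdge, ne_eq, Fin.ext_iff] at *
  omega

theorem baton_gt_of_notMem {S : Finset (Fin n)} {a x : Fin n} (hS : ConnFrom (baton n k) S a)
    (hx : x ∉ S) (h1 : k ≤ x.val) (h2 : x.val + k < n) (hax : x < a) : ∀ y ∈ S, x < y := by
  refine hS.2 {y | x < y} hax fun i hi j hj hix hadj => ?_
  have hne : j ≠ x := by rintro rfl; exact hx hj
  simp only [Set.mem_ofPred_eq, Fin.lt_def, baton_adj, BatonEdge, ne_eq, Fin.ext_iff] at *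
  omega

theorem baton_connFrom_of_subset {S : Finset (Fin n)} {p q : Fin n} (hp : p.val = k)
    (hq : q.val + k + 1 = n) (hS : Icc p q ⊆ S) (hpq : p ≤ q) : ConnFrom (baton n k) S p := by
  refine ⟨hS (by simp [hpq]), fun X hpX hX => ?_⟩
  have hpath : ∀ m (hm : m < n), k ≤ m → m + k < n → (⟨m, hm⟩ : Fin n) ∈ X := by
    intro m
    induction m with
    | zero => intro hm h1 h2; convert hpX using 1; ext; simp; omega
    | succ m ih =>
      intro hm h1 h2
      rcases h1.eq_or_lt with h1 | h1
      · convert hpX using 1; ext; simp; omega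
      · refine hX ⟨m, by omega⟩ (hS ?_) _ (hS ?_) (ih (by omega) (by omega) (by omega)) ?_
        · simp only [mem_Icc, Fin.le_def]; omega
        · simp only [mem_Icc, Fin.le_def]; omega
        · exact Or.inl (Or.inr (Or.inl ⟨Nat.lt_succ_iff.1 h1, rfl, h2⟩))
  have hpq' := Fin.le_def.1 hpq
  have hqX : q ∈ X := hpath q.val q.2 (by omega) (by omega)
  intro y hy
  by_cases h1 : k ≤ y.val
  · by_cases h2 : y.val + k < n
    · exact hpath y.val y.2 h1 h2
    · refine hX q (hS (by simp [hpq])) y hy hqX ?_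
      simp only [baton_adj, BatonEdge]; omega
  · refine hX p (hS (by simp [hpq])) y hy hpX ?_
    simp only [baton_adj, BatonEdge]; omega

theorem baton_subset_of_mem {S : Finset (Fin n)} {p q : Fin n} (hp : p.val = k)
    (hq : q.val + k + 1 = n) (hS : S ∈ subtrees (baton n k)) (hpS : p ∈ S) (hqS : q ∈ S) :
    Icc p q ⊆ S := by
  intro x hx
  by_contra hxS
  rw [mem_Icc, Fin.le_def, Fin.le_def] at hx
  have hlt : p < x := lt_of_le_of_ne (Fin.le_def.2 hx.1) (by rintro rfl; exact hxS hpS)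
  have := baton_lt_of_notMem (connFrom_iff.2 ⟨hpS, mem_subtrees.1 hS⟩) hxS (by omega) (by omega)
    hlt q hqS
  rw [Fin.lt_def] at this
  omega

theorem baton_eq_of_notMem_right {S : Finset (Fin n)} {p q : Fin n} (hp : p.val = k)
    (hq : q.val + k + 1 = n) (hS : S ∈ subtrees (baton n k)) (hpS : p ∈ S) (hqS : q ∉ S)
    (hpq : p ≤ q) : ∃ x, ∃ Y ∈ (Iio p).powerset, Ico p x ∪ Y = S := by
  have hne : (Icc p q \ S).Nonempty := ⟨q, by simp [hpq, hqS]⟩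
  -- The first missing path vertex stops `S`: what remains is a path segment from `p` and a set of
  -- left leaves.
  set x := (Icc p q \ S).min' hne with hx
  have hxm := min'_mem _ hne
  rw [← hx, mem_sdiff, mem_Icc, Fin.le_def, Fin.le_def] at hxm
  have hlt : p < x := lt_of_le_of_ne (Fin.le_def.2 hxm.1.1)
    (by intro h; rw [← h] at hxm; exact hxm.2 hpS)
  have hall := baton_lt_of_notMem (connFrom_iff.2 ⟨hpS, mem_subtrees.1 hS⟩) hxm.2 (by omega)
    (by omega) hlt
  refine ⟨x, S ∩ Iio p, by simp, ?_⟩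
  ext y
  simp only [mem_union, mem_Ico, mem_inter, mem_Iio]
  constructor
  · rintro (⟨h1, h2⟩ | h)
    · by_contra hy
      have := min'_le (Icc p q \ S) y (by
        simp only [mem_sdiff, mem_Icc]
        exact ⟨⟨h1, h2.le.trans (Fin.le_def.2 hxm.1.2)⟩, hy⟩)
      exact absurd h2 (not_lt.2 this)
    · exact h.1
  · intro hy
    rcases le_or_gt p y with h | h
    · exact Or.inl ⟨h, hall y hy⟩
    · exact Or.inr ⟨hy, h⟩

theorem baton_eq_of_notMem_left {S : Finset (Fin n)} {p q : Fin n} (hp : p.val = k)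
    (hq : q.val + k + 1 = n) (hS : S ∈ subtrees (baton n k)) (hpS : p ∉ S) (hqS : q ∈ S)
    (hpq : p ≤ q) : ∃ x, ∃ Y ∈ (Ioi q).powerset, Ioc x q ∪ Y = S := by
  have hne : (Icc p q \ S).Nonempty := ⟨p, by simp [hpq, hpS]⟩
  set x := (Icc p q \ S).max' hne with hx
  have hxm := max'_mem _ hne
  rw [← hx, mem_sdiff, mem_Icc, Fin.le_def, Fin.le_def] at hxm
  have hlt : x < q := lt_of_le_of_ne (Fin.le_def.2 hxm.1.2)
    (by intro h; rw [h] at hxm; exact hxm.2 hqS)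
  have hall := baton_gt_of_notMem (connFrom_iff.2 ⟨hqS, mem_subtrees.1 hS⟩) hxm.2 (by omega)
    (by omega) hlt
  refine ⟨x, S ∩ Ioi q, by simp, ?_⟩
  ext y
  simp only [mem_union, mem_Ioc, mem_inter, mem_Ioi]
  constructor
  · rintro (⟨h1, h2⟩ | h)
    · by_contra hy
      have := le_max' (Icc p q \ S) y (by
        simp only [mem_sdiff, mem_Icc]
        exact ⟨⟨(Fin.le_def.2 hxm.1.1).trans h1.le, h2⟩, hy⟩)
      exact absurd h1 (not_lt.2 this)
    · exact h.1
  · intro hy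
    rcases le_or_gt y q with h | h
    · exact Or.inl ⟨hall y hy, h⟩
    · exact Or.inr ⟨hy, h⟩

/-- Without both ends, a subtree is a single leaf or a segment of the path. -/
theorem baton_eq_Icc {S : Finset (Fin n)} {p q : Fin n} (hp : p.val = k)
    (hq : q.val + k + 1 = n) (hS : S ∈ subtrees (baton n k)) (hpS : p ∉ S) (hqS : q ∉ S) :
    ∃ a b, Icc a b = S := by
  have hc := mem_subtrees.1 hS
  obtain ⟨⟨s₀, hs₀⟩⟩ := hc.nonempty
  have hne : S.Nonempty := ⟨s₀, hs₀⟩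
  have hnp : ∀ y ∈ S, y ≠ p := by rintro y hy rfl; exact hpS hy
  have hnq : ∀ y ∈ S, y ≠ q := by rintro y hy rfl; exact hqS hy
  by_cases hleaf : ∃ s ∈ S, s < p ∨ q < s
  · obtain ⟨s, hs, hlt⟩ := hleaf
    refine ⟨s, s, ?_⟩
    have := (connFrom_iff.2 ⟨hs, hc⟩ : ConnFrom (baton n k) S s).2 {s} rfl ?_
    · rw [Icc_self]
      exact (eq_singleton_iff_unique_mem.2 ⟨hs, this⟩).symm
    · rintro x hx y hy rfl hadj
      have h1 := hnp y hy
      have h2 := hnq y hy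
      have h3 := hnp x hx
      have h4 := hnq x hx
      simp only [Fin.lt_def, baton_adj, BatonEdge, ne_eq, Fin.ext_iff] at *
      omega
  · push Not at hleaf
    refine ⟨S.min' hne, S.max' hne, ?_⟩
    ext x
    rw [mem_Icc]
    constructor
    · rintro ⟨h1, h2⟩
      by_contra hx
      have ha := min'_mem S hne
      have hb := max'_mem S hne
      have h1' : S.min' hne < x := lt_of_le_of_ne h1 (by rintro h; exact hx (h ▸ ha))
      have ha' := hleaf _ ha
      have hb' := hleaf _ hb
      have := baton_lt_of_notMem (connFrom_iff.2 ⟨ha, hc⟩) hx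
        (by simp only [Fin.le_def, Fin.lt_def] at *; omega)
        (by simp only [Fin.le_def, Fin.lt_def] at *; omega) h1' _ hb
      exact absurd h2 (not_le.2 this)
    · intro hx
      exact ⟨min'_le _ _ hx, le_max' _ _ hx⟩

/-- Complementation in `W` swaps present and missing elements. -/
theorem sum_powerset_card_sub {α : Type*} [DecidableEq α] (W : Finset α) :
    2 * ∑ Y ∈ W.powerset, ((#W : ℝ) - #Y) = #W * 2 ^ #W := by
  have h : ∑ Y ∈ W.powerset, ((#W : ℝ) - #Y) = ∑ Y ∈ W.powerset, (#Y : ℝ) := by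
    refine sum_nbij' (W \ ·) (W \ ·) ?_ ?_ ?_ ?_ ?_
    · intro Y _; simp
    · intro Y _; simp
    · intro Y hY; simpa using mem_powerset.1 hY
    · intro Y hY; simpa using mem_powerset.1 hY
    · intro Y hY
      rw [cast_card_sdiff (mem_powerset.1 hY)]
  rw [two_mul]
  nth_rewrite 2 [h]
  rw [← sum_add_distrib]
  simp [card_powerset, mul_comm]

/-- The two terms n 2^k count subtrees with exactly one end of the path (a stopping point and a set
of leaves); n² counts intervals. -/
theorem baton_card_nonspanning_le {p q : Fin n} (hp : p.val = k) (hq : q.val + k + 1 = n)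
    (hpq : p ≤ q) :
    #((subtrees (baton n k)).filter fun S => ¬ Icc p q ⊆ S) ≤ 2 * (n * 2 ^ k) + n * n := by
  let Q₁ : Finset (Finset (Fin n)) :=
    (univ ×ˢ (Iio p).powerset).image fun z => Ico p z.1 ∪ z.2
  let Q₂ : Finset (Finset (Fin n)) :=
    (univ ×ˢ (Ioi q).powerset).image fun z => Ioc z.1 q ∪ z.2
  let Q₃ : Finset (Finset (Fin n)) := univ.image fun z : Fin n × Fin n => Icc z.1 z.2
  have hsub : ((subtrees (baton n k)).filter fun S => ¬ Icc p q ⊆ S) ⊆ Q₁ ∪ Q₂ ∪ Q₃ := by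
    intro S hS
    rw [mem_filter] at hS
    obtain ⟨hS, hn⟩ := hS
    simp only [mem_union, Q₁, Q₂, Q₃, mem_image, mem_product, mem_univ, true_and, Prod.exists]
    by_cases hpS : p ∈ S <;> by_cases hqS : q ∈ S
    · exact absurd (baton_subset_of_mem hp hq hS hpS hqS) hn
    · obtain ⟨x, Y, h⟩ := baton_eq_of_notMem_right hp hq hS hpS hqS hpq
      exact Or.inl (Or.inl ⟨x, Y, h⟩)
    · obtain ⟨x, Y, h⟩ := baton_eq_of_notMem_left hp hq hS hpS hqS hpq
      exact Or.inl (Or.inr ⟨x, Y, h⟩)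
    · exact Or.inr (baton_eq_Icc hp hq hS hpS hqS)
  have c1 : #Q₁ ≤ n * 2 ^ k := by
    refine card_image_le.trans ?_
    rw [card_product, card_powerset, Fin.card_Iio, hp]; simp
  have c2 : #Q₂ ≤ n * 2 ^ k := by
    refine card_image_le.trans ?_
    rw [card_product, card_powerset, Fin.card_Ioi, show n - 1 - q.val = k by omega]; simp
  have c3 : #Q₃ ≤ n * n := by
    refine card_image_le.trans ?_
    simp
  have := card_le_card hsub
  have := card_union_le (Q₁ ∪ Q₂) Q₃
  have := card_union_le Q₁ Q₂
  omega

theorem baton_sum_spanning {p q : Fin n} (hp : p.val = k) (hq : q.val + k + 1 = n) (hpq : p ≤ q)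
    (f : Finset (Fin n) → ℝ) :
    ∑ S ∈ (subtrees (baton n k)).filter (fun S => Icc p q ⊆ S), f S =
      ∑ Y ∈ (Icc p q)ᶜ.powerset, f (Icc p q ∪ Y) := by
  refine sum_nbij' (· \ Icc p q) (Icc p q ∪ ·) ?_ ?_ ?_ ?_ ?_
  · intro S _
    simp only [mem_powerset]
    intro x hx
    simp only [mem_sdiff, mem_compl] at hx ⊢
    exact hx.2
  · intro Y _
    rw [mem_filter, mem_subtrees]
    exact ⟨(connFrom_iff.1 (baton_connFrom_of_subset hp hq subset_union_left hpq)).2,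
      subset_union_left⟩
  · intro S hS
    exact union_sdiff_of_subset (mem_filter.1 hS).2
  · intro Y hY
    rw [mem_powerset] at hY
    exact union_sdiff_cancel_left (disjoint_of_subset_right hY disjoint_compl_right)
  · intro S hS
    rw [union_sdiff_of_subset (mem_filter.1 hS).2]

theorem baton_meanSubtreeOrder_ge (h : 2 * k + 2 ≤ n) (hk : n ^ 2 ≤ 2 ^ k) :
    (n : ℝ) - k - 3 ≤ meanSubtreeOrder (baton n k) := by
  have hT := baton_isTree h
  let p : Fin n := ⟨k, by omega⟩
  let q : Fin n := ⟨n - k - 1, by omega⟩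
  have hp : p.val = k := rfl
  have hq : q.val + k + 1 = n := by simp only [q]; omega
  have hpq : p ≤ q := by simp only [Fin.le_def, p, q]; omega
  have hW : #(Icc p q)ᶜ = 2 * k := by
    rw [card_compl, Fin.card_Icc, Fintype.card_fin]; omega
  have hP : (#(Icc p q) : ℝ) = n - 2 * k := by
    have := card_compl_add_card (Icc p q)
    rw [hW, Fintype.card_fin] at this
    have : (2 * k + #(Icc p q) : ℝ) = n := by exact_mod_cast this
    linarith
  have hcount : (4 : ℝ) ^ k ≤ #(subtrees (baton n k)) := by
    have := baton_sum_spanning hp hq hpq fun _ => 1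
    simp only [sum_const, nsmul_eq_mul, mul_one, card_powerset, hW] at this
    calc (4 : ℝ) ^ k = ((2 ^ (2 * k) : ℕ) : ℝ) := by rw [pow_mul]; norm_num
      _ = _ := this.symm
      _ ≤ _ := by exact_mod_cast card_filter_le _ _
  have hfull : ∑ S ∈ (subtrees (baton n k)).filter (fun S => Icc p q ⊆ S), ((n : ℝ) - #S) =
      k * 4 ^ k := by
    rw [baton_sum_spanning hp hq hpq]
    have e : ∀ Y ∈ (Icc p q)ᶜ.powerset, ((n : ℝ) - #(Icc p q ∪ Y)) = #(Icc p q)ᶜ - #Y := by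
      intro Y hY
      rw [card_union_of_disjoint (disjoint_of_subset_right (mem_powerset.1 hY)
        disjoint_compl_right), hW]
      push_cast
      rw [hP]; ring
    rw [sum_congr rfl e]
    have := sum_powerset_card_sub (Icc p q)ᶜ
    rw [hW, pow_mul] at this
    rw [hW]
    push_cast at this ⊢
    rw [show (2 : ℝ) ^ 2 = 4 by norm_num] at this
    linarith
  have hrest : ∑ S ∈ (subtrees (baton n k)).filter (fun S => ¬ Icc p q ⊆ S), ((n : ℝ) - #S) ≤
      3 * 4 ^ k := by
    have h1 : ∑ S ∈ (subtrees (baton n k)).filter (fun S => ¬ Icc p q ⊆ S), ((n : ℝ) - #S) ≤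
        #((subtrees (baton n k)).filter fun S => ¬ Icc p q ⊆ S) • (n : ℝ) :=
      sum_le_card_nsmul _ _ _ fun S _ => by linarith [(Nat.cast_nonneg #S : (0 : ℝ) ≤ #S)]
    have h2 : #((subtrees (baton n k)).filter fun S => ¬ Icc p q ⊆ S) * n ≤ 3 * 4 ^ k := by
      calc _ ≤ (2 * (n * 2 ^ k) + n * n) * n :=
            Nat.mul_le_mul_right _ (baton_card_nonspanning_le hp hq hpq)
        _ = 2 * (n ^ 2 * 2 ^ k) + n ^ 2 * n := by ring
        _ ≤ 2 * (2 ^ k * 2 ^ k) + 2 ^ k * 2 ^ k := by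
            have : n ≤ 2 ^ k := le_trans (Nat.le_self_pow (by norm_num) n) hk
            gcongr
        _ = 3 * 4 ^ k := by rw [← mul_pow]; ring
    rw [nsmul_eq_mul] at h1
    exact h1.trans (by exact_mod_cast h2)
  have htot : ∑ S ∈ subtrees (baton n k), ((n : ℝ) - #S) ≤ (k + 3) * #(subtrees (baton n k)) := by
    rw [← sum_filter_add_sum_filter_not (subtrees (baton n k)) (fun S => Icc p q ⊆ S), hfull]
    have : ((k : ℝ) + 3) * 4 ^ k ≤ (k + 3) * #(subtrees (baton n k)) := by gcongr
    linarith
  have h0 : (0 : ℝ) < #(subtrees (baton n k)) := by exact_mod_cast card_pos.2 (subtrees_nonempty hT)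
  rw [meanSubtreeOrder_eq_sub hT, Fintype.card_fin]
  rw [← div_le_iff₀ h0] at htot
  linarith

end LowerBound

/-! ### Existence of the maximum and conclusion -/

theorem finite_meanSubtreeOrders (n : ℕ) : (meanSubtreeOrders n).Finite :=
  (Set.toFinite {T : SimpleGraph (Fin n) | T.IsTree}).image meanSubtreeOrder

theorem meanSubtreeOrders_nonempty {n : ℕ} (hn : 1 ≤ n) : (meanSubtreeOrders n).Nonempty := by
  have : Nonempty (Fin n) := ⟨⟨0, hn⟩⟩
  obtain ⟨T, -, hT⟩ := (SimpleGraph.connected_top (V := Fin n)).exists_isTree_le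
  exact ⟨_, T, hT, rfl⟩

theorem meanSubtreeOrder_nonneg {V : Type*} [Fintype V] (T : SimpleGraph V) :
    0 ≤ meanSubtreeOrder T := by
  unfold meanSubtreeOrder; positivity

theorem exists_meanSubtreeOrder_ge {n : ℕ} (hn : 64 ≤ n) :
    ∃ x ∈ meanSubtreeOrders n, (n : ℝ) - 2 * Real.logb 2 n - 4 ≤ x := by
  -- The least k with n² ≤ 2^k exceeds 2 log₂ n by at most 1.
  have hk1 : n ^ 2 ≤ 2 ^ Nat.clog 2 (n ^ 2) := Nat.le_pow_clog (by norm_num) _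
  have hk2 : 2 ^ (Nat.clog 2 (n ^ 2)).pred < n ^ 2 :=
    Nat.pow_pred_clog_lt_self (by norm_num) (by nlinarith)
  set k := Nat.clog 2 (n ^ 2)
  have hn0 : (64 : ℝ) ≤ n := by exact_mod_cast hn
  have hklog : (k : ℝ) ≤ 2 * Real.logb 2 n + 1 := by
    have h1 : ((2 : ℝ) ^ k.pred) ≤ (n : ℝ) ^ 2 := by exact_mod_cast hk2.le
    have h2 := Real.logb_le_logb_of_le (b := 2) (by norm_num) (by positivity) h1
    rw [Real.logb_pow, Real.logb_pow, Real.logb_self_eq_one (by norm_num), mul_one] at h2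
    have h3 : (k : ℝ) ≤ k.pred + 1 := by
      have : k ≤ k.pred + 1 := by simp only [Nat.pred_eq_sub_one]; omega
      exact_mod_cast this
    push_cast at h2
    linarith
  have hlog := logb_two_le (x := n) (a := 16) (by linarith) 4 (by norm_num)
  have h : 2 * k + 2 ≤ n := by
    have : (2 * k + 2 : ℝ) ≤ n := by push_cast at hlog; linarith
    exact_mod_cast this
  refine ⟨_, ⟨baton n k, baton_isTree h, rfl⟩, ?_⟩
  have := baton_meanSubtreeOrder_ge h hk1
  linarith

theorem theorem1p1 :
    ∃ C : ℝ, ∀ n : ℕ, 1 ≤ n →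
      ∃ M : ℝ, IsGreatest (meanSubtreeOrders n) M ∧
        |M - ((n : ℝ) - 2 * Real.logb 2 (n : ℝ))| ≤ C := by
  -- The bounds need only 14 and 4; 64 makes the lower estimate trivial for n < 64, where the baton
  -- construction is not invoked.
  refine ⟨64, fun n hn => ?_⟩
  obtain ⟨M, hM, hmax⟩ := (finite_meanSubtreeOrders n).exists_maximal
    (meanSubtreeOrders_nonempty hn)
  have hub : M ∈ upperBounds (meanSubtreeOrders n) := fun x hx =>
    (le_total x M).elim id fun h => hmax hx h
  refine ⟨M, ⟨hM, hub⟩, ?_⟩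
  obtain ⟨T, hT, hTM⟩ := hM
  have hupper := meanSubtreeOrder_le hT
  rw [hTM, Fintype.card_fin] at hupper
  rw [abs_le]
  refine ⟨?_, by linarith⟩
  rcases le_or_gt 64 n with h | h
  · obtain ⟨x, hx, hxM⟩ := exists_meanSubtreeOrder_ge h
    linarith [hub hx]
  · have h0 := meanSubtreeOrder_nonneg T
    have h1 : 0 ≤ Real.logb 2 n := Real.logb_nonneg (by norm_num) (by exact_mod_cast hn)
    have h2 : (n : ℝ) ≤ 64 := by exact_mod_cast h.le
    linarith
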